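/- Fix a finite alphabet $A$. A (numerical) monadic predicate is a family $\mathbf{P} = (\mathbf{P}_n)_{n \in \mathbb{N}}$ with $\mathbf{P}_n \subseteq \{0,\ldots,n-1\}$. It is uniform if there is a set $S \subseteq \mathbb{N}$ with $\mathbf{P}_n = S \cap \{0,\ldots,n-1\}$ for all $n$. It is regular if it is a boolean combination (taken separately for each length $n$, with complements in $\{0,\ldots,n-1\}$) of the local predicates $\{c\}$ and $(\{n-1-c\} \cap \{0,\ldots,n-1\})_n$, for $c \in \mathbb{N}$, and the modular predicates "$x \equiv r \bmod q$" and "$n-1 \equiv r \bmod q$", for $r,q \in \mathbb{N}$ with $q \geq 1$. Monadic second-order formulae with predicate symbols $\bar P = (P_1,\ldots,P_\ell)$ are built from the atoms $\mathbf{a}(x)$ ($a \in A$), $x \le y$, $x \in X$ and $P_k(x)$ by conjunction, negation, and quantification $\exists x$ over positions and $\exists X$ over sets of positions. For a sentence $\varphi(\bar P)$ (a formula without free variables) and a tuple $\bar{\mathbf{P}} = (\mathbf{P}_1,\ldots,\mathbf{P}_\ell)$ of monadic predicates, $L_{\varphi,\bar{\mathbf{P}}} \subseteq A^*$ is the language of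 the finite words $u$ that satisfy $\varphi$ when $P_k$ is interpreted by $(\mathbf{P}_k)_{n}$, where $n$ is the length of $u$. Theorem. For all sentences $\varphi(\bar P)$ and all tuples $\bar{\mathbf{P}}$ of uniform monadic predicates such that $L_{\varphi,\bar{\mathbf{P}}}$ is a regular language, there is a tuple $\bar{\mathbf{Q}}$ of monadic predicates, each of which is uniform and regular, such that $L_{\varphi,\bar{\mathbf{P}}} = L_{\varphi,\bar{\mathbf{Q}}}$. -/

import Mathlib

universe u

/-- A (numerical) monadic predicate: for every length `n`, a set of positions
`P n ⊆ {0, …, n - 1}`. -/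
abbrev MonadicPredicate : Type := (n : ℕ) → Set (Fin n)

namespace MonadicPredicate

/-- A monadic predicate is uniform if it comes from one subset of `ℕ`, independent of the
length. -/
def IsUniform (P : MonadicPredicate) : Prop :=
  ∃ S : Set ℕ, ∀ (n : ℕ) (i : Fin n), i ∈ P n ↔ (i : ℕ) ∈ S

/-- The local predicate `{c}`. -/
def point (c : ℕ) : MonadicPredicate := fun _ => {i | (i : ℕ) = c}

/-- The local predicate `last - c`, that is `({n - 1 - c})_n`; it is empty for lengths
`n ≤ c`. -/
def lastSub (c : ℕ) : MonadicPredicate := fun n => {i | (i : ℕ) + c + 1 = n}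

/-- The modular predicate `{x | x ≡ r mod q}`. -/
def posMod (r q : ℕ) : MonadicPredicate := fun _ => {i | (i : ℕ) ≡ r [MOD q]}

/-- The modular predicate `last ≡ r mod q`: all positions if `n - 1 ≡ r mod q`, none otherwise.
(There is no position when `n = 0`, so the subtraction never truncates.) -/
def lastMod (r q : ℕ) : MonadicPredicate := fun n => {_i | n - 1 ≡ r [MOD q]}

/-- The local and the modular predicates. -/
inductive IsBasic : MonadicPredicate → Prop
  | point (c : ℕ) : IsBasic (point c)
  | lastSub (c : ℕ) : IsBasic (lastSub c)
  | posMod (r q : ℕ) (hq : 0 < q) : IsBasic (posMod r q)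
  | lastMod (r q : ℕ) (hq : 0 < q) : IsBasic (lastMod r q)

/-- A monadic predicate is regular if it is a boolean combination of local and modular
predicates. The boolean operations are those of `(n : ℕ) → Set (Fin n)`: lengthwise, with the
complement taken in `{0, …, n - 1}`. -/
def IsRegular (P : MonadicPredicate) : Prop :=
  P ∈ BooleanSubalgebra.closure {B : MonadicPredicate | IsBasic B}

end MonadicPredicate

/-- Formulae of monadic second-order logic over words on the alphabet `A`, with predicate symbols
`P_0, …, P_(ℓ-1)`. `MSOFormula A ℓ p q` is the type of formulae whose free first-order variables
are among `x_0, …, x_(p-1)` and whose free second-order variables are among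
`X_0, …, X_(q-1)`; a quantifier binds the variable of index `0` of its body and the indices of
the other variables of the same sort are shifted by one. -/
inductive MSOFormula (A : Type u) (ℓ : ℕ) : ℕ → ℕ → Type u
  /-- `a(x)` -/
  | letter {p q : ℕ} (a : A) (x : Fin p) : MSOFormula A ℓ p q
  /-- `x ≤ y` -/
  | le {p q : ℕ} (x y : Fin p) : MSOFormula A ℓ p q
  /-- `x ∈ X` -/
  | mem {p q : ℕ} (x : Fin p) (X : Fin q) : MSOFormula A ℓ p q
  /-- `P_k(x)` -/
  | pred {p q : ℕ} (k : Fin ℓ) (x : Fin p) : MSOFormula A ℓ p q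
  | and {p q : ℕ} (φ ψ : MSOFormula A ℓ p q) : MSOFormula A ℓ p q
  | not {p q : ℕ} (φ : MSOFormula A ℓ p q) : MSOFormula A ℓ p q
  /-- `∃ x, φ` -/
  | existsFO {p q : ℕ} (φ : MSOFormula A ℓ (p + 1) q) : MSOFormula A ℓ p q
  /-- `∃ X, φ` -/
  | existsSO {p q : ℕ} (φ : MSOFormula A ℓ p (q + 1)) : MSOFormula A ℓ p q

namespace MSOFormula

variable {A : Type u} {ℓ : ℕ}

/-- `u, P, x, X ⊨ φ`: first-order variables are interpreted by positions of the word `u`,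
second-order variables by sets of positions, and the predicate symbol `P_k` by the set
`(P k) n` where `n` is the length of `u`. -/
def Sat (u : List A) (P : Fin ℓ → MonadicPredicate) :
    {p q : ℕ} → MSOFormula A ℓ p q →
      (Fin p → Fin u.length) → (Fin q → Set (Fin u.length)) → Prop
  | _, _, letter a x, v, _ => u.get (v x) = a
  | _, _, le x y, v, _ => v x ≤ v y
  | _, _, mem x X, v, V => v x ∈ V X
  | _, _, pred k x, v, _ => v x ∈ P k u.length
  | _, _, and φ ψ, v, V => Sat u P φ v V ∧ Sat u P ψ v V
  | _, _, not φ, v, V => ¬ Sat u P φ v V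
  | _, _, existsFO φ, v, V => ∃ i : Fin u.length, Sat u P φ (Fin.cons i v) V
  | _, _, existsSO φ, v, V => ∃ S : Set (Fin u.length), Sat u P φ v (Fin.cons S V)

end MSOFormula

/-- Sentences: formulae without free variables. -/
abbrev MSOSentence (A : Type u) (ℓ : ℕ) : Type u := MSOFormula A ℓ 0 0

/-- The language `L_{φ, P}` of the finite words satisfying the sentence `φ` when its predicate
symbols are interpreted by the predicates `P`. -/
def MSOSentence.language {A : Type u} {ℓ : ℕ} (φ : MSOSentence A ℓ)
    (P : Fin ℓ → MonadicPredicate) : Language A :=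
  {u | MSOFormula.Sat u P φ Fin.elim0 Fin.elim0}

/-! A uniform tuple is a single infinite word over `Set (Fin ℓ)`, the advice, whose prefix of length
`n` interprets the predicates on words of length `n`. Fix the regular language L defined with the
given advice. By Büchi's theorem (`exists_isRegular_encode_mem_iff`) and closure under complement
and projection, the finite advice words making the sentence agree with L at their length form a
regular language G (`exists_isRegular_advice`). All prefixes of the given advice lie in G.
Pigeonhole on the states of an automaton for G yields an ultimately periodic advice with the same
property (`exists_ultimatelyPeriodic`). It defines L too, and its tracks are regular predicates
(`isRegular_ofSet`). -/

/-! ### Closure properties of regular languages -/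

namespace Language.IsRegular

universe v w

variable {α : Type v} {β : Type w}

theorem preimage_map {L : Language β} (hL : L.IsRegular) (f : α → β) :
    Language.IsRegular (List.map f ⁻¹' L : Language α) := by
  obtain ⟨σ, hσ, M, rfl⟩ := hL
  exact ⟨σ, hσ, M.comap f, M.accepts_comap f⟩

theorem image_map {L : Language α} (hL : L.IsRegular) (f : α → β) :
    Language.IsRegular (List.map f '' L : Language β) := by
  classical
  obtain ⟨σ, hσ, M, rfl⟩ := hL
  -- Subset construction: after `w`, the state is the set of states `M` reaches on preimages of `w`.
  let N : DFA β (Set σ) :=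
    { step := fun T b => {t | ∃ s ∈ T, ∃ a, f a = b ∧ M.step s a = t}
      start := {M.start}
      accept := {T | ∃ t ∈ T, t ∈ M.accept} }
  have hN (w : List β) : N.eval w = {t | ∃ x, List.map f x = w ∧ M.eval x = t} := by
    induction w using List.reverseRecOn with
    | nil =>
      ext t
      simp [N, eq_comm]
    | append_singleton w b ih =>
      rw [DFA.eval_append_singleton, ih]
      ext t
      constructor
      · rintro ⟨_, ⟨x, hx, rfl⟩, a, ha, rfl⟩
        exact ⟨x ++ [a], by simp [hx, ha], by simp⟩
      · rintro ⟨x, hx, rfl⟩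
        obtain ⟨y, z, rfl, hy, hz⟩ := List.map_eq_append_iff.1 hx
        obtain ⟨a, rfl, ha⟩ := List.map_eq_singleton_iff.1 hz
        exact ⟨_, ⟨y, hy, rfl⟩, a, ha, by simp⟩
  refine ⟨Set σ, inferInstance, N, ?_⟩
  ext w
  rw [DFA.mem_accepts, hN]
  constructor
  · rintro ⟨_, ⟨x, hx, rfl⟩, h⟩
    exact ⟨x, h, hx⟩
  · rintro ⟨x, h, hx⟩
    exact ⟨_, ⟨x, hx, rfl⟩, h⟩

end Language.IsRegular

namespace Language

universe v

variable {α : Type v}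

/-- The words all of whose pairs of positions `i < j` avoid `p` at `i` together with `r` at `j`,
and the words with a letter in `p`, are recognised by one automaton up to the choice of the
accepting states. -/
theorem exists_dfa_eval_pairwise (p r : α → Prop) :
    ∃ M : DFA α (Prop × Prop), ∀ w,
      M.eval w = (w.Pairwise fun a b => ¬(p a ∧ r b), ∃ a ∈ w, p a) := by
  -- The state records whether no forbidden pair has occurred and whether `p` has been seen.
  refine ⟨⟨fun s c => (s.1 ∧ ¬(s.2 ∧ r c), s.2 ∨ p c), (True, False), ∅⟩, fun w => ?_⟩
  induction w using List.reverseRecOn with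
  | nil => simp
  | append_singleton w c ih =>
    rw [DFA.eval_append_singleton, ih]
    ext1
    · simp only [List.pairwise_append, List.pairwise_singleton, eq_iff_iff]
      refine and_congr_right fun _ => ?_
      simp
    · simp [or_and_right, exists_or]

theorem isRegular_setOf_pairwise (p r : α → Prop) :
    IsRegular ({w | w.Pairwise fun a b => ¬(p a ∧ r b)} : Language α) := by
  classical
  obtain ⟨M, hM⟩ := exists_dfa_eval_pairwise p r
  refine isRegular_iff.2 ⟨Prop × Prop, inferInstance, ⟨M.step, M.start, {s | s.1}⟩, ?_⟩
  ext w
  change (M.eval w).1 ↔ _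
  rw [hM]
  rfl

theorem isRegular_setOf_exists_mem (p : α → Prop) :
    IsRegular ({w | ∃ a ∈ w, p a} : Language α) := by
  classical
  obtain ⟨M, hM⟩ := exists_dfa_eval_pairwise p p
  refine isRegular_iff.2 ⟨Prop × Prop, inferInstance, ⟨M.step, M.start, {s | s.2}⟩, ?_⟩
  ext w
  change (M.eval w).2 ↔ _
  rw [hM]
  rfl

theorem IsRegular.setOf_iff {L₁ L₂ : Language α} (h₁ : L₁.IsRegular) (h₂ : L₂.IsRegular) :
    IsRegular ({w | w ∈ L₁ ↔ w ∈ L₂} : Language α) := by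
  refine (congrArg IsRegular ?_).mpr ((h₁.inf h₂).add (h₁.compl.inf h₂.compl))
  ext w
  change (w ∈ L₁ ↔ w ∈ L₂) ↔ (w ∈ L₁ ∧ w ∈ L₂) ∨ (¬ w ∈ L₁ ∧ ¬ w ∈ L₂)
  tauto

/-- If all prefixes of an infinite word belong to a regular language, then so do all prefixes of
some ultimately periodic word. -/
theorem IsRegular.exists_ultimatelyPeriodic {L : Language α} (hL : L.IsRegular) (s : ℕ → α)
    (hs : ∀ n, List.ofFn (fun i : Fin n => s i) ∈ L) :
    ∃ (t : ℕ → α) (N d : ℕ), 0 < d ∧ (∀ n, N ≤ n → t (n + d) = t n) ∧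
      ∀ n, List.ofFn (fun i : Fin n => t i) ∈ L := by
  obtain ⟨σ, hσ, M, rfl⟩ := hL
  let e (n : ℕ) : σ := M.eval (List.ofFn fun i : Fin n => s i)
  obtain ⟨i, j, hij, he⟩ : ∃ i j, i < j ∧ e i = e j := by
    obtain ⟨i, j, hne, he⟩ := Finite.exists_ne_map_eq_of_infinite e
    rcases hne.lt_or_gt with h | h
    exacts [⟨i, j, h, he⟩, ⟨j, i, h, he.symm⟩]
  -- Folds `ℕ` onto `[0, j)` by repeating the loop `[i, j)`; the new word is `s ∘ c`.
  let c (n : ℕ) : ℕ := if n < i then n else i + (n - i) % (j - i)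
  have e_succ (n : ℕ) : e (n + 1) = M.step (e n) (s n) := by
    simp only [e, List.ofFn_succ', List.concat_eq_append, DFA.eval_append_singleton]
    simp
  have c_succ (n : ℕ) : e (c n + 1) = e (c (n + 1)) := by
    rcases lt_trichotomy (n + 1) i with h | h | h
    · simp [c, h, show n < i by omega]
    · simp [c, h, show n < i by omega]
    · have h₁ : ¬ n < i := by omega
      have h₂ : ¬ n + 1 < i := by omega
      simp only [c, h₁, h₂, if_false]
      rw [show n + 1 - i = n - i + 1 by omega, Nat.add_mod_eq_ite]
      have hlt := Nat.mod_lt (n - i) (show 0 < j - i by omega)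
      rcases (show j - i = 1 ∨ 1 < j - i by omega) with h1 | h1
      · obtain rfl : j = i + 1 := by omega
        simpa [Nat.mod_one] using he.symm
      · rw [Nat.mod_eq_of_lt h1]
        split_ifs with h3
        · rw [show (n - i) % (j - i) + 1 - (j - i) = 0 by omega,
            show i + (n - i) % (j - i) + 1 = j by omega]
          exact he.symm
        · rfl
  -- The run on the new word only visits states that prefixes of `s` reach, so it stays accepting.
  have key (n : ℕ) : M.eval (List.ofFn fun k : Fin n => s (c k)) = e (c n) := by
    induction n with
    | zero =>
      have : c 0 = 0 := by
        by_cases h : 0 < i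
        · simp [c, h]
        · simp [c, show i = 0 by omega]
      simp [this, e]
    | succ n ih =>
      rw [List.ofFn_succ', List.concat_eq_append, DFA.eval_append_singleton]
      simp only [Fin.val_castSucc, Fin.val_last]
      rw [ih, ← e_succ, c_succ]
  refine ⟨fun n => s (c n), i, j - i, by omega, fun n hn => ?_, fun n => ?_⟩
  · simp only [c, show ¬ n < i by omega, show ¬ n + (j - i) < i by omega, if_false]
    rw [show n + (j - i) - i = n - i + (j - i) by omega, Nat.add_mod_right]
  · rw [DFA.mem_accepts, key]
    exact hs _

end Language

/-! ### Ultimately periodic sets give regular uniform predicates -/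

namespace MonadicPredicate

/-- The uniform predicate given by a set of natural numbers. -/
def ofSet (S : Set ℕ) : MonadicPredicate := fun _ => {i | (i : ℕ) ∈ S}

theorem isUniform_ofSet (S : Set ℕ) : (ofSet S).IsUniform := ⟨S, fun _ _ => Iff.rfl⟩

theorem isRegular_point (c : ℕ) : (point c).IsRegular :=
  BooleanSubalgebra.subset_closure (IsBasic.point c)

theorem isRegular_posMod (r : ℕ) {q : ℕ} (hq : 0 < q) : (posMod r q).IsRegular :=
  BooleanSubalgebra.subset_closure (IsBasic.posMod r q hq)

theorem isRegular_finset_sup {ι : Type*} (s : Finset ι) {f : ι → MonadicPredicate}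
    (hf : ∀ i ∈ s, (f i).IsRegular) : (s.sup f).IsRegular :=
  Finset.sup_induction BooleanSubalgebra.bot_mem (fun _ h _ => BooleanSubalgebra.sup_mem h) hf

theorem mem_finset_sup {ι : Type*} (s : Finset ι) (f : ι → MonadicPredicate) {n : ℕ}
    {x : Fin n} : x ∈ s.sup f n ↔ ∃ i ∈ s, x ∈ f i n := by
  simp [Finset.sup_apply]

theorem isRegular_ofSet {S : Set ℕ} {N d : ℕ} (hd : 0 < d)
    (hS : ∀ n, N ≤ n → (n + d ∈ S ↔ n ∈ S)) : (ofSet S).IsRegular := by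
  classical
  have hS' (n : ℕ) (hn : N ≤ n) (k : ℕ) : n + d * k ∈ S ↔ n ∈ S := by
    induction k with
    | zero => simp
    | succ k ih => rw [← ih, ← hS (n + d * k) (by omega), Nat.mul_succ, add_assoc]
  -- Below `N`, list the points; from `N` on, take the residue classes of the members of one period
  -- `[N, N + d)`.
  have key : ofSet S = ((Finset.range N).filter (· ∈ S)).sup point ⊔
      (((Finset.Ico N (N + d)).filter (· ∈ S)).sup (posMod · d) \
        (Finset.range N).sup point) := by
    ext n x
    simp only [Pi.sup_apply, Pi.sdiff_apply, Set.sup_eq_union, Set.mem_union, Set.mem_sdiff,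
      mem_finset_sup, Finset.mem_filter, Finset.mem_range, Finset.mem_Ico, point, posMod, ofSet,
      Set.mem_ofPred_eq]
    constructor
    · intro hx
      by_cases h : (x : ℕ) < N
      · exact .inl ⟨x, ⟨h, hx⟩, rfl⟩
      · have hx' : (N + (x - N) % d) + d * ((x - N) / d) = x := by
          rw [add_assoc, Nat.mod_add_div]
          omega
        refine .inr ⟨⟨N + (x - N) % d, ⟨⟨by omega, ?_⟩, ?_⟩, ?_⟩, ?_⟩
        · have := Nat.mod_lt (x - N) hd
          omega
        · rwa [← hS' _ (by omega) ((x - N) / d), hx']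
        · conv_lhs => rw [← hx']
          simp [Nat.ModEq]
        · rintro ⟨i, hi, hxi⟩
          omega
    · rintro (⟨i, ⟨-, hi⟩, hxi⟩ | ⟨⟨i, ⟨⟨hNi, hi⟩, hiS⟩, hxi⟩, h⟩)
      · rwa [hxi]
      · have hxN : N ≤ (x : ℕ) := by
          by_contra hlt
          exact h ⟨x, by omega, rfl⟩
        rcases le_total i (x : ℕ) with hle | hle
        · obtain ⟨k, hk⟩ := (Nat.modEq_iff_dvd' hle).1 hxi.symm
          rw [show (x : ℕ) = i + d * k by omega, hS' i hNi]
          exact hiS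
        · obtain ⟨k, hk⟩ := (Nat.modEq_iff_dvd' hle).1 hxi
          rw [← hS' x hxN k, show (x : ℕ) + d * k = i by omega]
          exact hiS
  rw [key]
  exact BooleanSubalgebra.sup_mem (isRegular_finset_sup _ fun _ _ => isRegular_point _)
    (BooleanSubalgebra.sdiff_mem (isRegular_finset_sup _ fun _ _ => isRegular_posMod _ hd)
      (isRegular_finset_sup _ fun _ _ => isRegular_point _))

end MonadicPredicate

/-! ### From formulae to regular languages -/

namespace MSOFormula

/-- Letters carrying the set of predicate symbols and the sets of variables of either sort that
hold at a position. -/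
abbrev Letter (A : Type u) (ℓ p q : ℕ) : Type u :=
  A × Set (Fin ℓ) × Set (Fin p) × Set (Fin q)

/-- The word over `Letter A ℓ p q` that represents a word with predicates and a valuation. -/
def encode {A : Type u} {ℓ p q : ℕ} (u : List A) (P : Fin ℓ → MonadicPredicate)
    (v : Fin p → Fin u.length) (V : Fin q → Set (Fin u.length)) : List (Letter A ℓ p q) :=
  List.ofFn fun i => (u.get i, {k | i ∈ P k u.length}, {x | v x = i}, {X | i ∈ V X})

variable {A : Type u} {ℓ p q : ℕ}

theorem mem_encode {u : List A} {P : Fin ℓ → MonadicPredicate} {v : Fin p → Fin u.length}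
    {V : Fin q → Set (Fin u.length)} {c : Letter A ℓ p q} :
    c ∈ encode u P v V ↔
      ∃ i, (u.get i, {k | i ∈ P k u.length}, {x | v x = i}, {X | i ∈ V X}) = c :=
  List.mem_ofFn

theorem exists_ofFn_of_map_eq_ofFn {α β : Type*} {f : α → β} {w : List α} {n : ℕ}
    {g : Fin n → β} (h : w.map f = List.ofFn g) :
    ∃ g' : Fin n → α, w = List.ofFn g' ∧ ∀ i, f (g' i) = g i := by
  have hn : w.length = n := by simpa using congrArg List.length h
  subst hn
  refine ⟨w.get, (List.ofFn_get w).symm, fun i => ?_⟩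
  have := congrArg (·[(i : ℕ)]?) h
  simpa using this

/-- Forgetting the set variable of index `0`. -/
def forgetSO (c : Letter A ℓ p (q + 1)) : Letter A ℓ p q :=
  (c.1, c.2.1, c.2.2.1, {X | X.succ ∈ c.2.2.2})

/-- Forgetting the position variable of index `0`. -/
def forgetFO (c : Letter A ℓ (p + 1) q) : Letter A ℓ p q :=
  (c.1, c.2.1, {x | x.succ ∈ c.2.2.1}, c.2.2.2)

theorem encode_mem_image_forgetSO {u : List A} {P : Fin ℓ → MonadicPredicate}
    {v : Fin p → Fin u.length} {V : Fin q → Set (Fin u.length)}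
    {L : Language (Letter A ℓ p (q + 1))} :
    encode u P v V ∈ List.map forgetSO '' L ↔ ∃ S, encode u P v (Fin.cons S V) ∈ L := by
  constructor
  · rintro ⟨w, hw, h⟩
    obtain ⟨g, rfl, hg⟩ := exists_ofFn_of_map_eq_ofFn h
    refine ⟨{i | 0 ∈ (g i).2.2.2}, ?_⟩
    refine (congrArg (· ∈ L) (congrArg List.ofFn (funext fun i => ?_))).mpr hw
    have hi := hg i
    simp only [forgetSO, Prod.mk.injEq] at hi
    obtain ⟨h1, h2, h3, h4⟩ := hi
    ext1
    · exact h1.symm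
    ext1
    · exact h2.symm
    ext1
    · exact h3.symm
    ext X
    refine Fin.cases ?_ (fun X => ?_) X
    · simp
    · exact (Set.ext_iff.1 h4 X).symm
  · rintro ⟨S, hS⟩
    refine ⟨_, hS, ?_⟩
    simp only [encode, List.map_ofFn]
    refine congrArg List.ofFn (funext fun i => ?_)
    simp [forgetSO]

/-- A preimage under `forgetFO` may carry any set on track `0`. The two extra conditions force a
singleton, hence a position. -/
theorem encode_mem_image_forgetFO {u : List A} {P : Fin ℓ → MonadicPredicate}
    {v : Fin p → Fin u.length} {V : Fin q → Set (Fin u.length)}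
    {L : Language (Letter A ℓ (p + 1) q)} :
    encode u P v V ∈ List.map forgetFO ''
        {w | w ∈ L ∧ (∃ c ∈ w, 0 ∈ c.2.2.1) ∧
          w.Pairwise fun c c' => ¬(0 ∈ c.2.2.1 ∧ 0 ∈ c'.2.2.1)} ↔
      ∃ i, encode u P (Fin.cons i v) V ∈ L := by
  constructor
  · rintro ⟨w, ⟨hw, h0, hu⟩, h⟩
    obtain ⟨g, rfl, hg⟩ := exists_ofFn_of_map_eq_ofFn h
    obtain ⟨c, hc, h0⟩ := h0
    obtain ⟨j, rfl⟩ := List.mem_ofFn.1 hc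
    rw [List.pairwise_ofFn] at hu
    have huniq (i : Fin u.length) : j = i ↔ 0 ∈ (g i).2.2.1 := by
      constructor
      · rintro rfl
        exact h0
      · intro hi
        rcases lt_trichotomy j i with hlt | rfl | hlt
        · exact absurd ⟨h0, hi⟩ (hu hlt)
        · rfl
        · exact absurd ⟨hi, h0⟩ (hu hlt)
    refine ⟨j, ?_⟩
    refine (congrArg (· ∈ L) (congrArg List.ofFn (funext fun i => ?_))).mpr hw
    have hi := hg i
    simp only [forgetFO, Prod.mk.injEq] at hi
    obtain ⟨h1, h2, h3, h4⟩ := hi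
    ext1
    · exact h1.symm
    ext1
    · exact h2.symm
    ext1
    · ext x
      refine Fin.cases ?_ (fun x => ?_) x
      · exact huniq i
      · exact (Set.ext_iff.1 h3 x).symm
    · exact h4.symm
  · rintro ⟨j, hj⟩
    refine ⟨_, ⟨hj, ⟨_, mem_encode.2 ⟨j, rfl⟩, rfl⟩, ?_⟩, ?_⟩
    · refine List.pairwise_ofFn.2 fun i i' hlt => ?_
      rintro ⟨h, h'⟩
      exact hlt.ne (h.symm.trans h')
    · simp only [encode, List.map_ofFn]
      refine congrArg List.ofFn (funext fun i => ?_)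
      simp [forgetFO]

/-- Büchi's theorem: every formula defines a regular language of encoded words. -/
theorem exists_isRegular_encode_mem_iff (φ : MSOFormula A ℓ p q) :
    ∃ L : Language (Letter A ℓ p q), L.IsRegular ∧
      ∀ (u : List A) (P : Fin ℓ → MonadicPredicate) (v : Fin p → Fin u.length)
        (V : Fin q → Set (Fin u.length)), encode u P v V ∈ L ↔ Sat u P φ v V := by
  induction φ with
  | letter a x =>
    refine ⟨_, Language.isRegular_setOf_exists_mem fun c => x ∈ c.2.2.1 ∧ c.1 = a,
      fun u P v V => ?_⟩
    change (∃ c ∈ encode u P v V, _) ↔ _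
    simp [mem_encode, Sat]
  | le x y =>
    -- `x ≤ y` fails exactly when the mark of `y` strictly precedes that of `x`.
    refine ⟨_, Language.isRegular_setOf_pairwise (fun c => y ∈ c.2.2.1) (fun c => x ∈ c.2.2.1),
      fun u P v V => ?_⟩
    change List.Pairwise _ (List.ofFn _) ↔ _
    rw [List.pairwise_ofFn, Sat]
    constructor
    · exact fun h => not_lt.1 fun hlt => h hlt ⟨rfl, rfl⟩
    · rintro h i j hlt ⟨rfl, rfl⟩
      exact hlt.not_ge h
  | mem x X =>
    refine ⟨_, Language.isRegular_setOf_exists_mem fun c => x ∈ c.2.2.1 ∧ X ∈ c.2.2.2,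
      fun u P v V => ?_⟩
    change (∃ c ∈ encode u P v V, _) ↔ _
    simp [mem_encode, Sat]
  | pred k x =>
    refine ⟨_, Language.isRegular_setOf_exists_mem fun c => x ∈ c.2.2.1 ∧ k ∈ c.2.1,
      fun u P v V => ?_⟩
    change (∃ c ∈ encode u P v V, _) ↔ _
    simp [mem_encode, Sat]
  | and φ ψ ihφ ihψ =>
    obtain ⟨L, hL, h⟩ := ihφ
    obtain ⟨L', hL', h'⟩ := ihψ
    exact ⟨_, hL.inf hL', fun u P v V => and_congr (h u P v V) (h' u P v V)⟩
  | not φ ih =>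
    obtain ⟨L, hL, h⟩ := ih
    exact ⟨_, hL.compl, fun u P v V => not_congr (h u P v V)⟩
  | existsFO φ ih =>
    obtain ⟨L, hL, h⟩ := ih
    refine ⟨_, (hL.inf ((Language.isRegular_setOf_exists_mem fun c => 0 ∈ c.2.2.1).inf
      (Language.isRegular_setOf_pairwise (fun c => 0 ∈ c.2.2.1)
        (fun c => 0 ∈ c.2.2.1)))).image_map forgetFO, fun u P v V => ?_⟩
    exact encode_mem_image_forgetFO.trans (exists_congr fun i => h u P _ V)
  | existsSO φ ih =>
    obtain ⟨L, hL, h⟩ := ih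
    exact ⟨_, hL.image_map forgetSO, fun u P v V =>
      encode_mem_image_forgetSO.trans (exists_congr fun S => h u P v _)⟩

theorem map_fst_encode (u : List A) (P : Fin ℓ → MonadicPredicate) (v : Fin p → Fin u.length)
    (V : Fin q → Set (Fin u.length)) : (encode u P v V).map Prod.fst = u := by
  simp only [encode, List.map_ofFn]
  exact List.ofFn_get u

theorem map_pred_encode (u : List A) (P : Fin ℓ → MonadicPredicate) (v : Fin p → Fin u.length)
    (V : Fin q → Set (Fin u.length)) :
    (encode u P v V).map (fun c => c.2.1) = List.ofFn fun i => {k | i ∈ P k u.length} := by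
  simp only [encode, List.map_ofFn]
  rfl

end MSOFormula

/-! ### Regularity of the correct advice, and the main theorem -/

/-- The interpretations of the predicate symbols, as words, for which a sentence agrees with a
given regular language on the words of their length, form a regular language. -/
theorem MSOSentence.exists_isRegular_advice {A : Type u} {ℓ : ℕ} (φ : MSOSentence A ℓ)
    {L : Language A} (hL : L.IsRegular) :
    ∃ G : Language (Set (Fin ℓ)), G.IsRegular ∧
      ∀ (P : Fin ℓ → MonadicPredicate) (n : ℕ), List.ofFn (fun i : Fin n => {k | i ∈ P k n}) ∈ G ↔
        ∀ u : List A, u.length = n → (u ∈ L ↔ u ∈ φ.language P) := by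
  obtain ⟨K, hK, hφ⟩ := φ.exists_isRegular_encode_mem_iff
  -- Bad advice is the projection of the encoded words on which `L` and the sentence disagree.
  refine ⟨_, (((hL.preimage_map Prod.fst).setOf_iff hK).compl.image_map fun c => c.2.1).compl,
    fun P n => ?_⟩
  change ¬(∃ w : List (MSOFormula.Letter A ℓ 0 0), ¬(w.map Prod.fst ∈ L ↔ w ∈ K) ∧
    w.map (fun c => c.2.1) = _) ↔ _
  constructor
  · rintro h u rfl
    by_contra hu
    refine h ⟨MSOFormula.encode u P Fin.elim0 Fin.elim0, ?_, MSOFormula.map_pred_encode ..⟩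
    rwa [MSOFormula.map_fst_encode, hφ]
  · rintro h ⟨w, hw, hwP⟩
    have hn : (w.map Prod.fst).length = n := by simpa using congrArg List.length hwP
    refine hw ((h _ hn).trans ?_)
    refine (hφ (w.map Prod.fst) P Fin.elim0 Fin.elim0).symm.trans ?_
    suffices MSOFormula.encode (w.map Prod.fst) P Fin.elim0 Fin.elim0 = w by rw [this]
    subst hn
    obtain ⟨g, hg, hgP⟩ := MSOFormula.exists_ofFn_of_map_eq_ofFn hwP
    obtain ⟨g', hg', hgA⟩ :=
      MSOFormula.exists_ofFn_of_map_eq_ofFn (List.ofFn_get (w.map Prod.fst)).symm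
    obtain rfl : g = g' := List.ofFn_injective (hg.symm.trans hg')
    refine Eq.trans (congrArg List.ofFn (funext fun i => ?_)) hg.symm
    ext1
    · exact (hgA i).symm
    ext1
    · exact (hgP i).symm
    · exact Subsingleton.elim _ _

theorem mainTheorem7 {A : Type*} [Finite A] {ℓ : ℕ} (φ : MSOSentence A ℓ)
    (P : Fin ℓ → MonadicPredicate) (hP : ∀ k, MonadicPredicate.IsUniform (P k))
    (hL : (MSOSentence.language φ P).IsRegular) :
    ∃ Q : Fin ℓ → MonadicPredicate,
      (∀ k, MonadicPredicate.IsUniform (Q k) ∧ MonadicPredicate.IsRegular (Q k)) ∧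
        MSOSentence.language φ P = MSOSentence.language φ Q := by
  choose S hS using hP
  obtain ⟨G, hG, hGP⟩ := φ.exists_isRegular_advice hL
  obtain ⟨t, N, d, hd, ht, htG⟩ := hG.exists_ultimatelyPeriodic (fun n => {k | n ∈ S k})
    fun n => by
      -- Uniformity is used here: the advice for length `n` is the prefix of one infinite word.
      simp only [← hS]
      exact (hGP P n).2 fun _ _ => Iff.rfl
  refine ⟨fun k => .ofSet {n | k ∈ t n}, fun k => ⟨MonadicPredicate.isUniform_ofSet _,
    MonadicPredicate.isRegular_ofSet (N := N) hd fun n hn => ?_⟩, ?_⟩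
  · simp [ht n hn]
  · ext u
    exact (hGP (fun k => .ofSet {n | k ∈ t n}) u.length).1 (htG u.length) u rfl
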